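/- Let $d\ge 0$ be an integer and let $S\subset\mathbb{R}^d$ be bounded and Borel measurable (or, more generally, bounded and Lebesgue measurable with $S-S=\{x-y : x,y\in S\}$ also Lebesgue measurable). For real $n>0$ let $T_n=(\mathbb{R}/n\mathbb{Z})^d$ be the $d$-dimensional torus of side length $n$, with quotient map $\pi_n:\mathbb{R}^d\to T_n$. For $k\ge 0$ choose $t_1,\dots,t_k\in T_n$ independently and uniformly at random, and let $p_k(n^d)$ be the probability that the $k$ translated copies $t_1+\pi_n(S),\dots,t_k+\pi_n(S)$ are pairwise disjoint. Then, for all $n>0$ and $k\ge0$, this event is measurable (for the completion of the product of the uniform measures), and there are polynomials $P_0,P_1,P_2,\dots\in\mathbb{R}[x]$ such that: 1. for every $k\ge 0$ there is $n_0$ such that $n^{dk}p_k(n^d)=P_k(n^d)$ for all real $n>0$ with $n\ge n_0$; 2. the sequence $(P_k)_{k\ge 0}$ is of binomial type, that is, $P_0=1$, $P_k(0)=0$ for all $k>0$, and for all $k\ge 0$ and all $x,y\in\mathbb{R}$, $$P_k(x+y)=\sum_{i=0}^{k}\binom{k}{i}P_i(x)\,P_{k-i}(y).$$ -/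

import Mathlib

open MeasureTheory Polynomial
open scoped Pointwise

noncomputable section

/-- The `d`-dimensional torus of side length `L`, i.e. `(ℝ / Lℤ)^d`. -/
abbrev Torus (d : ℕ) (L : ℝ) : Type := Fin d → AddCircle L

/-- The quotient map from Euclidean space to the torus. -/
def toTorus (d : ℕ) (L : ℝ) (x : EuclideanSpace ℝ (Fin d)) : Torus d L :=
  fun i => (x i : AddCircle L)

/-- The copy of `S` placed at position `t` of the torus: the image of `S`, translated by `t`. -/
def copyAt {d : ℕ} (L : ℝ) (S : Set (EuclideanSpace ℝ (Fin d))) (t : Torus d L) :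
    Set (Torus d L) :=
  (fun x => t + toTorus d L x) '' S

/-- The uniform probability measure on the torus. -/
def uniformTorus (d : ℕ) (L : ℝ) [Fact (0 < L)] : Measure (Torus d L) :=
  Measure.pi fun _ => AddCircle.haarAddCircle

instance (d : ℕ) (L : ℝ) [Fact (0 < L)] : IsProbabilityMeasure (uniformTorus d L) := by
  unfold uniformTorus; infer_instance

/-- The law of `k` independent uniformly distributed positions on the torus. -/
def placementLaw (d : ℕ) (L : ℝ) [Fact (0 < L)] (k : ℕ) : Measure (Fin k → Torus d L) :=
  Measure.pi fun _ => uniformTorus d L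

/-- The event that no two of the `k` copies of `S` intersect. -/
def noOverlap {d : ℕ} (L : ℝ) (S : Set (EuclideanSpace ℝ (Fin d))) (k : ℕ) :
    Set (Fin k → Torus d L) :=
  {t | ∀ i j, i ≠ j → Disjoint (copyAt L S (t i)) (copyAt L S (t j))}

/-- The probability that `k` copies of `S`, placed independently and uniformly at random on the
torus of side length `L`, are pairwise disjoint. -/
def noOverlapProb {d : ℕ} (L : ℝ) [Fact (0 < L)] (S : Set (EuclideanSpace ℝ (Fin d)))
    (k : ℕ) : ℝ :=
  (placementLaw d L k).real (noOverlap L S k)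

/-- Polynomial sequences of binomial type, in the traditional normalization (with the binomial
coefficient in the addition formula). -/
structure IsBinomialType (P : ℕ → ℝ[X]) : Prop where
  zero_eq_one : P 0 = 1
  eval_zero : ∀ k, 0 < k → (P k).eval 0 = 0
  eval_add : ∀ (k : ℕ) (x y : ℝ),
    (P k).eval (x + y) =
      ∑ i ∈ Finset.range (k + 1), (k.choose i : ℝ) * (P i).eval x * (P (k - i)).eval y

end

/-! ### Universal measurability of analytic sets -/

section Analytic
open Filter Topology Set

/-! Two copies are disjoint exactly when the difference of their positions avoids the image of `S -
S`, so the event is a hard-core gas of bounded range. Let `f A` be the hard-core indicator of the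
points in `A`, `f₀ A` the same with an extra point at the origin, and define the rooted Ursell
function `u` by `f₀ A = ∑ B ⊆ A, u B * f (A \ B)`. The factors of each term depend on disjoint sets
of coordinates, and by translation invariance the root may be any uniform point. Integrating gives
`c (k+1) = ∑ m, k.choose m * w m * c (k-m)`, with `c` the probabilities and `w` the integrals of `u`
(`integral_hardCore_succ`).

The function `u` vanishes unless its points chain back to the origin
(`norm_le_of_hardCoreUrsell_ne_zero`). On a large torus such clusters do not wrap around, so
`L^(d*m) * w m` is a constant `a m` (`integral_hardCoreUrsell_torus`). After rescaling, the
recursion is that of `clusterPoly a` at `x = L^d`. Its exponential generating function solves `F' =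
x A F`, `F(0) = 1`, where `A` is that of `a`; hence `F` is exponential in `x`, which is binomial
type.

Measurability for Borel `S` holds because `S - S` is analytic, hence null measurable. -/

theorem isCompact_setOf_forall_le (g : ℕ → ℕ) : IsCompact {x : ℕ → ℕ | ∀ i, x i ≤ g i} := by
  have : {x : ℕ → ℕ | ∀ i, x i ≤ g i} = Set.pi univ fun i => Set.Iic (g i) := by
    ext; simp [Pi.le_def]
  rw [this]
  exact isCompact_univ_pi fun i => (Set.finite_Iic (g i)).isCompact

/-- A compact box in Baire space, contained in an open set, has a finitely determined
neighbourhood inside that open set. -/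
theorem exists_forall_lt_le_subset_of_isOpen (g : ℕ → ℕ) {V : Set (ℕ → ℕ)} (hV : IsOpen V)
    (hg : {x | ∀ i, x i ≤ g i} ⊆ V) : ∃ n, {x : ℕ → ℕ | ∀ i < n, x i ≤ g i} ⊆ V := by
  by_contra! h
  simp only [Set.not_subset] at h
  choose x hx hxV using h
  have hK := isCompact_setOf_forall_le g
  -- Truncation by `g` moves the counterexamples into the compact box without changing the first `n`
  -- coordinates of the `n`-th one, so the limit along the subsequence is the same.
  obtain ⟨y, hy, φ, hφ, hlim⟩ := hK.tendsto_subseq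
    (x := fun n i => min (x n i) (g i)) (fun n i => min_le_right _ _)
  have hlim' : Tendsto (x ∘ φ) atTop (𝓝 y) := by
    rw [tendsto_pi_nhds] at hlim ⊢
    intro i
    refine (hlim i).congr' ?_
    filter_upwards [hφ.tendsto_atTop.eventually_gt_atTop i] with n hn
    exact min_eq_left (hx _ _ hn)
  obtain ⟨n, hn⟩ := (hlim'.eventually (hV.mem_nhds (hg hy))).exists
  exact hxV _ hn

/-- Inner regularity of finite measures on analytic sets. -/
theorem MeasureTheory.AnalyticSet.exists_isCompact_le_measure {X : Type*} [TopologicalSpace X]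
    [MeasurableSpace X] [BorelSpace X] {μ : Measure X} [μ.OuterRegular]
    {A : Set X} (hA : AnalyticSet A) {c : ENNReal} (hc : c < μ A) :
    ∃ K ⊆ A, IsCompact K ∧ c ≤ μ K := by
  rw [AnalyticSet] at hA
  rcases hA with rfl | ⟨f, hf, rfl⟩
  · simp at hc
  -- Some bound on coordinate `n` keeps the measure above `c`: outer measure is continuous along
  -- increasing unions even of nonmeasurable sets.
  have step : ∀ (B : Set (ℕ → ℕ)) (n : ℕ), ∃ m : ℕ,
      c < μ (f '' B) → c < μ (f '' (B ∩ {x | x n ≤ m})) := by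
    intro B n
    by_cases hB : c < μ (f '' B)
    · have hU : f '' B = ⋃ m : ℕ, f '' (B ∩ {x | x n ≤ m}) := by
        rw [← image_iUnion, ← inter_iUnion]
        congr 1
        refine (inter_eq_left.2 fun x _ => mem_iUnion.2 ⟨x n, by simp⟩).symm
      have hmono : Monotone fun m : ℕ => f '' (B ∩ {x | x n ≤ m}) := fun a b hab =>
        image_mono (inter_subset_inter_right _ fun x (hx : x n ≤ a) => hx.trans hab)
      rw [hU, hmono.measure_iUnion, lt_iSup_iff] at hB
      exact hB.imp fun m hm _ => hm
    · exact ⟨0, fun h => absurd h hB⟩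
  choose m hm using step
  let B : ℕ → Set (ℕ → ℕ) := fun n => Nat.rec univ (fun k C => C ∩ {x | x k ≤ m C k}) n
  let g : ℕ → ℕ := fun n => m (B n) n
  have hB : ∀ n, c < μ (f '' B n) := fun n => by
    induction n with
    | zero => simpa [B] using hc
    | succ n ih => exact hm _ _ ih
  have hBg : ∀ n, B n = {x | ∀ i < n, x i ≤ g i} := fun n => by
    induction n with
    | zero => simp [B]
    | succ n ih =>
      have : B (n + 1) = B n ∩ {x | x n ≤ g n} := rfl
      rw [this, ih]
      ext x
      simp only [mem_inter_iff, mem_ofPred_eq, Nat.lt_succ_iff_lt_or_eq, or_imp, forall_and,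
        forall_eq]
  have hK := isCompact_setOf_forall_le g
  refine ⟨f '' {x | ∀ i, x i ≤ g i}, image_subset_range _ _, hK.image hf, ?_⟩
  -- Continuity from above is not available for the possibly nonmeasurable images of `B n`. Instead,
  -- each open set containing the compact image contains the image of some `B n`, of measure above
  -- `c`.
  rw [Set.measure_eq_iInf_isOpen]
  refine le_iInf₂ fun U hU => le_iInf fun hUo => ?_
  obtain ⟨n, hn⟩ := exists_forall_lt_le_subset_of_isOpen g (hUo.preimage hf) (image_subset_iff.1 hU)
  rw [← hBg] at hn
  exact (hB n).le.trans (measure_mono (image_subset_iff.2 hn))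

/-- Analytic sets are universally measurable. -/
theorem MeasureTheory.AnalyticSet.nullMeasurableSet {X : Type*} [TopologicalSpace X]
    [TopologicalSpace.MetrizableSpace X] [MeasurableSpace X] [BorelSpace X] {μ : Measure X}
    [SFinite μ] {A : Set X} (hA : AnalyticSet A) : NullMeasurableSet A μ := by
  obtain ⟨ν, hν, hμν, -⟩ := exists_isFiniteMeasure_absolutelyContinuous μ
  refine NullMeasurableSet.mono_ac ?_ hμν
  let _ := TopologicalSpace.metrizableSpaceMetric X
  have hM : ∃ M ⊆ A, MeasurableSet M ∧ ν A ≤ ν M := by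
    rcases eq_or_ne (ν A) 0 with h0 | h0
    · exact ⟨∅, empty_subset _, .empty, by simp [h0]⟩
    obtain ⟨c, -, hc, hlim⟩ := exists_seq_strictMono_tendsto' (pos_iff_ne_zero.2 h0)
    choose K hKA hK hcK using fun n => hA.exists_isCompact_le_measure (hc n).2
    refine ⟨⋃ n, K n, iUnion_subset hKA, .iUnion fun n => (hK n).measurableSet, ?_⟩
    exact le_of_tendsto' hlim fun n => (hcK n).trans (measure_mono (subset_iUnion _ _))
  obtain ⟨M, hMA, hMm, hle⟩ := hM
  have h1 : M =ᵐ[ν] toMeasurable ν A :=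
    ae_eq_of_subset_of_measure_ge (hMA.trans (subset_toMeasurable _ _))
      (by rwa [measure_toMeasurable]) hMm.nullMeasurableSet (measure_ne_top _ _)
  refine hMm.nullMeasurableSet.congr ?_
  refine hMA.eventuallyLE.antisymm ?_
  exact (subset_toMeasurable ν A).eventuallyLE.trans h1.symm.le

end Analytic

/-! ### Rooted Ursell functions -/

section Ursell
open Finset

variable {ι : Type*} [DecidableEq ι]

/-- The rooted Ursell function `u` of a pair of set functions, determined by
`f₀ A = ∑ B ⊆ A, u B * f (A \ B)`. -/
def rootedUrsell (f₀ f : Finset ι → ℝ) (A : Finset ι) : ℝ :=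
  f₀ A - ∑ B ∈ A.ssubsets.attach, rootedUrsell f₀ f B.1 * f (A \ B.1)
termination_by A.card
decreasing_by exact Finset.card_lt_card (Finset.mem_ssubsets.1 B.2)

theorem rootedUrsell_eq (f₀ f : Finset ι → ℝ) (A : Finset ι) :
    rootedUrsell f₀ f A = f₀ A - ∑ B ∈ A.ssubsets, rootedUrsell f₀ f B * f (A \ B) := by
  rw [rootedUrsell, Finset.sum_attach A.ssubsets fun B => rootedUrsell f₀ f B * f (A \ B)]

theorem sum_powerset_eq_add_sum_ssubsets {M : Type*} [AddCommMonoid M] (g : Finset ι → M)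
    (A : Finset ι) : ∑ B ∈ A.powerset, g B = g A + ∑ B ∈ A.ssubsets, g B := by
  rw [Finset.ssubsets, Finset.add_sum_erase _ _ (Finset.mem_powerset_self A)]

theorem sum_rootedUrsell_mul (f₀ f : Finset ι → ℝ) (hf : f ∅ = 1) (A : Finset ι) :
    ∑ B ∈ A.powerset, rootedUrsell f₀ f B * f (A \ B) = f₀ A := by
  rw [sum_powerset_eq_add_sum_ssubsets, Finset.sdiff_self, hf, mul_one, rootedUrsell_eq f₀ f A]
  ring

/-- The rooted Ursell function vanishes on a set part of which is separated from the root. -/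
theorem rootedUrsell_eq_zero {f₀ f : Finset ι → ℝ} {T C : Finset ι} (hf : f ∅ = 1)
    (hfC : ∀ A ⊆ T, f A = f (A \ C) * f (A ∩ C))
    (hf₀C : ∀ A ⊆ T, f₀ A = f₀ (A \ C) * f (A ∩ C)) (A : Finset ι) (hA : A ⊆ T)
    (hAC : (A ∩ C).Nonempty) : rootedUrsell f₀ f A = 0 := by
  induction A using Finset.strongInduction with
  | H A ih =>
    -- By induction only the `B` missing `C` contribute. For these `f (A ∩ C)` factors out, and the
    -- remaining sum is `f₀ (A \ C)`, so the total is `f₀ A`.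
    have hsum : ∑ B ∈ A.ssubsets, rootedUrsell f₀ f B * f (A \ B) =
        ∑ B ∈ (A \ C).powerset, rootedUrsell f₀ f B * f ((A \ C) \ B) * f (A ∩ C) := by
      symm
      refine Finset.sum_subset_zero_on_sdiff ?_ ?_ ?_
      · intro B hB
        rw [Finset.mem_powerset] at hB
        rw [Finset.mem_ssubsets]
        refine ⟨hB.trans Finset.sdiff_subset, fun h => ?_⟩
        obtain ⟨x, hx⟩ := hAC
        rw [Finset.mem_inter] at hx
        exact (Finset.mem_sdiff.1 (hB (h hx.1))).2 hx.2
      · intro B hB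
        rw [Finset.mem_sdiff, Finset.mem_ssubsets, Finset.mem_powerset] at hB
        rw [ih B hB.1 (hB.1.1.trans hA), zero_mul]
        rw [Finset.nonempty_iff_ne_empty]
        intro h
        exact hB.2 (Finset.subset_sdiff.2 ⟨hB.1.1, Finset.disjoint_iff_inter_eq_empty.2 h⟩)
      · intro B hB
        rw [Finset.mem_powerset, Finset.subset_sdiff] at hB
        rw [hfC (A \ B) (Finset.sdiff_subset.trans hA), mul_assoc, sdiff_right_comm]
        congr 3
        ext x
        have : x ∈ B → x ∉ C := fun hx => Finset.disjoint_left.1 hB.2 hx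
        simp only [Finset.mem_inter, Finset.mem_sdiff]
        tauto
    rw [rootedUrsell_eq, hsum, ← Finset.sum_mul, sum_rootedUrsell_mul _ _ hf, ← hf₀C A hA, sub_self]

end Ursell

/-! ### Hard-core indicators and their factorization -/

section HardCore
open Finset

variable {ι G : Type*} [AddGroup G]

/-- The configurations of points none of whose mutual differences lies in `E`. -/
def hardCoreSet (E : Set G) (A : Finset ι) : Set (ι → G) :=
  {s | ∀ i ∈ A, ∀ j ∈ A, i ≠ j → s i - s j ∉ E}

/-- The configurations of points such that neither the points nor their negatives lie in `E`. -/
def avoidSet (E : Set G) (A : Finset ι) : Set (ι → G) :=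
  {s | ∀ i ∈ A, s i ∉ E ∧ -s i ∉ E}

/-- The indicator of the hard-core condition for the points with index in `A`. -/
noncomputable def hardCore (E : Set G) (s : ι → G) (A : Finset ι) : ℝ :=
  (hardCoreSet E A).indicator 1 s

/-- The indicator of the hard-core condition for the points with index in `A`, and an additional
point at the origin. -/
noncomputable def rootedHardCore (E : Set G) (s : ι → G) (A : Finset ι) : ℝ :=
  (avoidSet E A ∩ hardCoreSet E A).indicator 1 s

/-- The rooted Ursell function of the hard-core gas. -/
noncomputable def hardCoreUrsell [DecidableEq ι] (E : Set G) (s : ι → G) (A : Finset ι) : ℝ :=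
  rootedUrsell (rootedHardCore E s) (hardCore E s) A

theorem hardCore_empty (E : Set G) (s : ι → G) : hardCore E s ∅ = 1 := by
  simp [hardCore, hardCoreSet]

variable [DecidableEq ι]

theorem mem_hardCoreSet_iff_of_separated {E : Set G} {s : ι → G} {A C : Finset ι}
    (h : ∀ i ∈ A \ C, ∀ j ∈ A ∩ C, s i - s j ∉ E ∧ s j - s i ∉ E) :
    s ∈ hardCoreSet E A ↔ s ∈ hardCoreSet E (A \ C) ∧ s ∈ hardCoreSet E (A ∩ C) := by
  simp only [hardCoreSet, Set.mem_ofPred_eq, mem_sdiff, mem_inter] at h ⊢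
  constructor
  · exact fun H => ⟨fun i hi j hj => H i hi.1 j hj.1, fun i hi j hj => H i hi.1 j hj.1⟩
  · intro H i hi j hj hij
    by_cases hiC : i ∈ C <;> by_cases hjC : j ∈ C
    · exact H.2 i ⟨hi, hiC⟩ j ⟨hj, hjC⟩ hij
    · exact (h j ⟨hj, hjC⟩ i ⟨hi, hiC⟩).2
    · exact (h i ⟨hi, hiC⟩ j ⟨hj, hjC⟩).1
    · exact H.1 i ⟨hi, hiC⟩ j ⟨hj, hjC⟩ hij

theorem hardCore_eq_mul_of_separated {E : Set G} {s : ι → G} {A C : Finset ι}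
    (h : ∀ i ∈ A \ C, ∀ j ∈ A ∩ C, s i - s j ∉ E ∧ s j - s i ∉ E) :
    hardCore E s A = hardCore E s (A \ C) * hardCore E s (A ∩ C) := by
  classical
  simp only [hardCore, Set.indicator_apply, mem_hardCoreSet_iff_of_separated h, Pi.one_apply]
  split_ifs <;> simp_all

theorem rootedHardCore_eq_mul_of_separated {E : Set G} {s : ι → G} {A C : Finset ι}
    (h₀ : ∀ j ∈ A ∩ C, s j ∉ E ∧ -s j ∉ E)
    (h : ∀ i ∈ A \ C, ∀ j ∈ A ∩ C, s i - s j ∉ E ∧ s j - s i ∉ E) :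
    rootedHardCore E s A = rootedHardCore E s (A \ C) * hardCore E s (A ∩ C) := by
  classical
  have h1 : s ∈ avoidSet E A ↔ s ∈ avoidSet E (A \ C) := by
    simp only [avoidSet, Set.mem_ofPred_eq, mem_sdiff, mem_inter] at h₀ ⊢
    refine ⟨fun H i hi => H i hi.1, fun H i hi => ?_⟩
    by_cases hiC : i ∈ C
    · exact h₀ i ⟨hi, hiC⟩
    · exact H i ⟨hi, hiC⟩
  simp only [rootedHardCore, hardCore, Set.indicator_apply, Set.mem_inter_iff,
    mem_hardCoreSet_iff_of_separated h, h1, Pi.one_apply]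
  split_ifs <;> simp_all

end HardCore

/-! ### Support of the Ursell function -/

section Support
open Finset

variable {ι G : Type*} [SeminormedAddCommGroup G] [DecidableEq ι]

/-- The rooted Ursell function of a hard-core gas with interaction range `R` is supported on
clusters around the origin. -/
theorem norm_le_of_hardCoreUrsell_ne_zero {E : Set G} {R : ℝ} (hR : 0 ≤ R) (hE : ∀ x ∈ E, ‖x‖ ≤ R)
    {s : ι → G} {A : Finset ι} (hu : hardCoreUrsell E s A ≠ 0) {i : ι} (hi : i ∈ A) :
    ‖s i‖ ≤ A.card * R := by
  -- Each increase of the radius by `R` must capture a new point until `A` is exhausted. Otherwise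
  -- an empty shell of width `R` separates `A \ D n` from both `D n` and the root, and the Ursell
  -- function vanishes.
  let D : ℕ → Finset ι := fun n => A.filter fun j => ‖s j‖ ≤ n * R
  have hD : ∀ n, D n = A ∨ n ≤ (D n).card := by
    intro n
    induction n with
    | zero => exact .inr (Nat.zero_le _)
    | succ n ih =>
      have hmono : D n ⊆ D (n + 1) := by
        refine Finset.monotone_filter_right A fun j _ hj => hj.trans ?_
        push_cast
        nlinarith
      rcases ih with h | h
      · exact .inl (subset_antisymm (filter_subset _ _) (h ▸ hmono))
      · by_contra! hcon
        have heq : D n = D (n + 1) := eq_of_subset_of_card_le hmono (by omega)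
        have hfar : ∀ j ∈ A \ D n, (n + 1) * R < ‖s j‖ := by
          intro j hj
          rw [heq, mem_sdiff, mem_filter, not_and, not_le] at hj
          have := hj.2 hj.1
          push_cast at this
          exact this
        have hsep₀ : ∀ B ⊆ A, ∀ j ∈ B ∩ (A \ D n), s j ∉ E ∧ -s j ∉ E := by
          intro B hB j hj
          have h1 := hfar j (mem_inter.1 hj).2
          have h2 : R < ‖s j‖ := by nlinarith [mul_nonneg n.cast_nonneg hR]
          exact ⟨fun h => (hE _ h).not_gt h2, fun h => (hE _ h).not_gt (by rwa [norm_neg])⟩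
        have hsep : ∀ B ⊆ A, ∀ i ∈ B \ (A \ D n), ∀ j ∈ B ∩ (A \ D n),
            s i - s j ∉ E ∧ s j - s i ∉ E := by
          intro B hB i hi j hj
          have h1 := hfar j (mem_inter.1 hj).2
          have h2 : ‖s i‖ ≤ n * R := by
            rw [mem_sdiff, mem_sdiff, not_and, not_not] at hi
            exact (mem_filter.1 (hi.2 (hB hi.1))).2
          have h3 : R < ‖s j - s i‖ := by
            have := norm_sub_norm_le (s j) (s i)
            linarith
          exact ⟨fun h => (hE _ h).not_gt (by rwa [norm_sub_rev]), fun h => (hE _ h).not_gt h3⟩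
        refine hu (rootedUrsell_eq_zero (T := A) (C := A \ D n) (hardCore_empty E s)
          (fun B hB => hardCore_eq_mul_of_separated (hsep B hB))
          (fun B hB => rootedHardCore_eq_mul_of_separated (hsep₀ B hB) (hsep B hB)) A subset_rfl ?_)
        rw [inter_eq_right.2 sdiff_subset, sdiff_nonempty]
        exact fun h' => hcon.1 (subset_antisymm (filter_subset _ _) (h'.trans hmono))
  have hA : D A.card = A :=
    (hD A.card).elim id fun h => eq_of_subset_of_card_le (filter_subset _ _) h
  exact (mem_filter.1 (hA.symm ▸ hi : i ∈ D A.card)).2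

end Support

/-! ### Independence of disjoint sets of coordinates -/

section Product
open Finset

/-- Functions depending on complementary sets of coordinates are independent. -/
theorem integral_mul_eq_of_dependsOn {ι G : Type*} [Fintype ι] [MeasurableSpace G]
    [Nonempty G] (μ : Measure G) [IsProbabilityMeasure μ] {φ ψ : (ι → G) → ℝ} {B : Set ι}
    (hφ : DependsOn φ B) (hψ : DependsOn ψ Bᶜ) :
    ∫ s, φ s * ψ s ∂(Measure.pi fun _ => μ) =
      (∫ s, φ s ∂(Measure.pi fun _ => μ)) * ∫ s, ψ s ∂(Measure.pi fun _ => μ) := by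
  classical
  let e := MeasurableEquiv.piEquivPiSubtypeProd (fun _ : ι => G) (· ∈ B)
  have he : MeasurePreserving e (Measure.pi fun _ : ι => μ)
      ((Measure.pi fun _ : {i // i ∈ B} => μ).prod (Measure.pi fun _ : {i // i ∉ B} => μ)) :=
    measurePreserving_piEquivPiSubtypeProd (fun _ : ι => μ) (· ∈ B)
  obtain ⟨z⟩ := ‹Nonempty G›
  let φ' : ({i // i ∈ B} → G) → ℝ := fun x => φ (e.symm (x, fun _ => z))
  let ψ' : ({i // i ∉ B} → G) → ℝ := fun y => ψ (e.symm (fun _ => z, y))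
  have h1 : ∀ s, φ s = φ' (e s).1 := fun s => hφ fun i hi => by
    simp [e, MeasurableEquiv.piEquivPiSubtypeProd, Equiv.piEquivPiSubtypeProd, hi]
  have h2 : ∀ s, ψ s = ψ' (e s).2 := fun s => hψ fun i hi => by
    rw [Set.mem_compl_iff] at hi
    simp [e, MeasurableEquiv.piEquivPiSubtypeProd, Equiv.piEquivPiSubtypeProd, hi]
  have key : ∀ (a : ({i // i ∈ B} → G) → ℝ) (b : ({i // i ∉ B} → G) → ℝ),
      ∫ s, a (e s).1 * b (e s).2 ∂(Measure.pi fun _ => μ) =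
        (∫ x, a x ∂(Measure.pi fun _ => μ)) * ∫ y, b y ∂(Measure.pi fun _ => μ) := fun a b => by
    rw [he.integral_comp' (g := fun z => a z.1 * b z.2), integral_prod_mul]
  -- Setting one factor to `1` identifies the integrals over the partial products with those over
  -- the full product.
  have h3 := key φ' fun _ => 1
  have h4 := key (fun _ => 1) ψ'
  simp only [mul_one, one_mul, integral_const, probReal_univ, smul_eq_mul] at h3 h4
  simp only [h1, h2, key, h3, h4]

end Product

/-! ### The recursion for the hard-core gas on a compact group -/

section Gas
open Finset

variable {ι G : Type*} [AddCommGroup G]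

theorem dependsOn_hardCore (E : Set G) (A : Finset ι) :
    DependsOn (fun s : ι → G => hardCore E s A) A := by
  classical
  intro s t h
  have : s ∈ hardCoreSet E A ↔ t ∈ hardCoreSet E A :=
    forall₂_congr fun i hi => forall₂_congr fun j hj => by rw [h i hi, h j hj]
  simp only [hardCore, Set.indicator_apply, this, Pi.one_apply]

theorem dependsOn_rootedHardCore (E : Set G) (A : Finset ι) :
    DependsOn (fun s : ι → G => rootedHardCore E s A) A := by
  classical
  intro s t h
  have h1 : s ∈ hardCoreSet E A ↔ t ∈ hardCoreSet E A :=
    forall₂_congr fun i hi => forall₂_congr fun j hj => by rw [h i hi, h j hj]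
  have h2 : s ∈ avoidSet E A ↔ t ∈ avoidSet E A :=
    forall₂_congr fun i hi => by rw [h i hi]
  simp only [rootedHardCore, Set.indicator_apply, Set.mem_inter_iff, h1, h2, Pi.one_apply]

theorem dependsOn_hardCoreUrsell [DecidableEq ι] (E : Set G) (A : Finset ι) :
    DependsOn (fun s : ι → G => hardCoreUrsell E s A) A := by
  induction A using Finset.strongInduction with
  | H A ih =>
    intro s t h
    simp only [hardCoreUrsell, rootedUrsell_eq _ _ A]
    congr 1
    · exact dependsOn_rootedHardCore E A h
    · refine Finset.sum_congr rfl fun B hB => ?_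
      rw [Finset.mem_ssubsets] at hB
      congr 1
      · exact ih B hB fun i hi => h i (hB.1 hi)
      · exact dependsOn_hardCore E (A \ B) fun i hi => h i (Finset.sdiff_subset hi)

/-- The hard-core condition for `n + 1` points is the rooted one for the positions relative to the
first point. -/
theorem hardCore_univ_succ {E : Set G} {n : ℕ} (t : Fin (n + 1) → G) :
    hardCore E t univ = rootedHardCore E (fun i : Fin n => t i.succ - t 0) univ := by
  classical
  have : t ∈ hardCoreSet E univ ↔
      (fun i : Fin n => t i.succ - t 0) ∈ avoidSet E univ ∩ hardCoreSet E univ := by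
    simp only [hardCoreSet, avoidSet, Set.mem_inter_iff, Set.mem_ofPred_eq, Fin.forall_fin_succ,
      mem_univ, true_imp_iff, sub_sub_sub_cancel_right, neg_sub, ne_eq, Fin.succ_inj,
      Fin.succ_ne_zero, not_false_eq_true, (Fin.succ_ne_zero _).symm, not_true, false_imp_iff,
      true_and, forall_and]
    tauto
  simp only [hardCore, rootedHardCore, Set.indicator_apply, this, Pi.one_apply]

theorem mem_hardCoreSet_iff_comp_equivFin {E : Set G} (A : Finset ι) {s : ι → G} :
    s ∈ hardCoreSet E A ↔ (s ∘ fun i => (A.equivFin.symm i : ι)) ∈ hardCoreSet E univ := by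
  simp only [hardCoreSet, Set.mem_ofPred_eq, mem_univ, true_imp_iff, Function.comp_apply]
  refine ⟨fun h i j hij => h _ (A.equivFin.symm i).2 _ (A.equivFin.symm j).2
    (Subtype.val_injective.ne (A.equivFin.symm.injective.ne hij)), fun h i hi j hj hij => ?_⟩
  simpa using h (A.equivFin ⟨i, hi⟩) (A.equivFin ⟨j, hj⟩) (by simpa using hij)

theorem mem_avoidSet_iff_comp_equivFin {E : Set G} (A : Finset ι) {s : ι → G} :
    s ∈ avoidSet E A ↔ (s ∘ fun i => (A.equivFin.symm i : ι)) ∈ avoidSet E univ := by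
  simp only [avoidSet, Set.mem_ofPred_eq, mem_univ, true_imp_iff, Function.comp_apply]
  refine ⟨fun h i => h _ (A.equivFin.symm i).2, fun h i hi => ?_⟩
  simpa using h (A.equivFin ⟨i, hi⟩)

variable [TopologicalSpace G] [IsTopologicalAddGroup G] [CompactSpace G]
  [SecondCountableTopology G] [MeasurableSpace G] [BorelSpace G]
  {μ : Measure G} [μ.IsAddHaarMeasure] [IsProbabilityMeasure μ]

/-- A continuous surjective homomorphism of compact groups carries Haar probability measure to Haar
probability measure. The same principle covers relabelling of coordinates and passage to positions
relative to the first point. -/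
theorem measurePreserving_apply_sub_apply [Fintype ι] {i j : ι} (hij : i ≠ j) :
    MeasurePreserving (fun s : ι → G => s i - s j) (Measure.pi fun _ => μ) μ := by
  classical
  exact AddMonoidHom.measurePreserving
    (f := Pi.evalAddMonoidHom (fun _ : ι => G) i - Pi.evalAddMonoidHom (fun _ : ι => G) j)
    ((continuous_apply i).sub (continuous_apply j))
    (fun x => ⟨Pi.single i x, by simp [hij.symm]⟩) (by simp)

theorem measurePreserving_comp_injective {κ : Type*} [Fintype ι] [Fintype κ] {e : κ → ι}
    (he : Function.Injective e) :
    MeasurePreserving (fun s : ι → G => s ∘ e) (Measure.pi fun _ => μ) (Measure.pi fun _ => μ) :=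
  AddMonoidHom.measurePreserving
    (f := AddMonoidHom.mk' (fun s : ι → G => s ∘ e) fun _ _ => rfl)
    (continuous_pi fun i => continuous_apply (e i))
    he.surjective_comp_right (by simp)

theorem measurePreserving_sub_zero (n : ℕ) :
    MeasurePreserving (fun (t : Fin (n + 1) → G) (i : Fin n) => t i.succ - t 0)
      (Measure.pi fun _ => μ) (Measure.pi fun _ => μ) :=
  AddMonoidHom.measurePreserving
    (f := AddMonoidHom.mk' (fun (t : Fin (n + 1) → G) (i : Fin n) => t i.succ - t 0)
      fun s t => funext fun i => add_sub_add_comm _ _ _ _)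
    (continuous_pi fun i => (continuous_apply _).sub (continuous_apply _))
    (fun s => ⟨Fin.cons 0 s, by ext; simp⟩) (by simp)

variable {E : Set G}

theorem nullMeasurableSet_hardCoreSet (hE : NullMeasurableSet E μ) [Fintype ι] (A : Finset ι) :
    NullMeasurableSet (hardCoreSet E A) (Measure.pi fun _ : ι => μ) := by
  have : hardCoreSet E A = ⋂ i ∈ A, ⋂ j ∈ A, ⋂ _ : i ≠ j, {s | s i - s j ∈ E}ᶜ := by
    ext; simp [hardCoreSet]
  rw [this]
  refine .biInter A.countable_toSet fun i _ => .biInter A.countable_toSet fun j _ =>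
    .iInter fun hij => ?_
  exact (hE.preimage (measurePreserving_apply_sub_apply hij).quasiMeasurePreserving).compl

omit [SecondCountableTopology G] in
theorem nullMeasurableSet_avoidSet (hE : NullMeasurableSet E μ) [Fintype ι] (A : Finset ι) :
    NullMeasurableSet (avoidSet E A) (Measure.pi fun _ : ι => μ) := by
  have : avoidSet E A = ⋂ i ∈ A, ({s | s i ∈ E}ᶜ ∩ {s | -s i ∈ E}ᶜ) := by
    ext; simp [avoidSet]
  rw [this]
  refine .biInter A.countable_toSet fun i _ => ?_
  have h := measurePreserving_eval (fun _ : ι => μ) i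
  exact (hE.preimage h.quasiMeasurePreserving).compl.inter (hE.preimage
    ((Measure.measurePreserving_neg μ).comp h).quasiMeasurePreserving).compl

theorem memLp_hardCore (hE : NullMeasurableSet E μ) [Fintype ι] (A : Finset ι) :
    MemLp (fun s : ι → G => hardCore E s A) ⊤ (Measure.pi fun _ => μ) := by
  refine .of_bound (C := 1) ?_ ?_
  · exact aestronglyMeasurable_const.indicator₀ (nullMeasurableSet_hardCoreSet hE A)
  · exact .of_forall fun s => (norm_indicator_le_norm_self _ _).trans (by simp)

theorem memLp_rootedHardCore (hE : NullMeasurableSet E μ) [Fintype ι] (A : Finset ι) :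
    MemLp (fun s : ι → G => rootedHardCore E s A) ⊤ (Measure.pi fun _ => μ) := by
  refine .of_bound (C := 1) ?_ ?_
  · exact aestronglyMeasurable_const.indicator₀
      ((nullMeasurableSet_avoidSet hE A).inter (nullMeasurableSet_hardCoreSet hE A))
  · exact .of_forall fun s => (norm_indicator_le_norm_self _ _).trans (by simp)

theorem memLp_hardCoreUrsell (hE : NullMeasurableSet E μ) [Fintype ι] [DecidableEq ι] (A : Finset ι) :
    MemLp (fun s : ι → G => hardCoreUrsell E s A) ⊤ (Measure.pi fun _ => μ) := by
  induction A using Finset.strongInduction with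
  | H A ih =>
    simp only [hardCoreUrsell, rootedUrsell_eq _ _ A] at ih ⊢
    refine (memLp_rootedHardCore hE A).sub (memLp_finsetSum _ fun B hB => ?_)
    exact (memLp_hardCore hE (A \ B)).mul (p := ⊤) (q := ⊤) (ih B (Finset.mem_ssubsets.1 hB))

theorem integral_hardCore_eq (hE : NullMeasurableSet E μ) [Fintype ι] (A : Finset ι) :
    ∫ s : ι → G, hardCore E s A ∂(Measure.pi fun _ => μ) =
      ∫ s : Fin A.card → G, hardCore E s univ ∂(Measure.pi fun _ => μ) := by
  classical
  have he : Function.Injective fun i => (A.equivFin.symm i : ι) :=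
    Subtype.val_injective.comp A.equivFin.symm.injective
  have hm := measurePreserving_comp_injective (μ := μ) he
  rw [← hm.map_eq, integral_map hm.aemeasurable]
  · congr 1 with s
    simp only [hardCore, Set.indicator_apply, mem_hardCoreSet_iff_comp_equivFin A, Pi.one_apply]
  · rw [hm.map_eq]
    exact (memLp_hardCore hE _).1

theorem integral_rootedHardCore_eq (hE : NullMeasurableSet E μ) [Fintype ι] (A : Finset ι) :
    ∫ s : ι → G, rootedHardCore E s A ∂(Measure.pi fun _ => μ) =
      ∫ s : Fin (A.card + 1) → G, hardCore E s univ ∂(Measure.pi fun _ => μ) := by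
  classical
  have h0 := measurePreserving_sub_zero (μ := μ) A.card
  have h1 : ∫ s : Fin (A.card + 1) → G, hardCore E s univ ∂(Measure.pi fun _ => μ) =
      ∫ s : Fin A.card → G, rootedHardCore E s univ ∂(Measure.pi fun _ => μ) := by
    simp only [hardCore_univ_succ]
    conv_rhs => rw [← h0.map_eq]
    rw [integral_map h0.aemeasurable]
    rw [h0.map_eq]
    exact (memLp_rootedHardCore hE _).1
  rw [h1]
  have he : Function.Injective fun i => (A.equivFin.symm i : ι) :=
    Subtype.val_injective.comp A.equivFin.symm.injective
  have hm := measurePreserving_comp_injective (μ := μ) he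
  rw [← hm.map_eq, integral_map hm.aemeasurable]
  · congr 1 with s
    simp only [rootedHardCore, Set.indicator_apply, Set.mem_inter_iff,
      mem_hardCoreSet_iff_comp_equivFin A, mem_avoidSet_iff_comp_equivFin A, Pi.one_apply]
  · rw [hm.map_eq]
    exact (memLp_rootedHardCore hE _).1

/-- The root at the origin stands for one more uniform point, by translation invariance. Each term
of the Ursell expansion splits by independence, `B` and `A \ B` being disjoint. -/
theorem integral_hardCore_succ_eq_sum (hE : NullMeasurableSet E μ) [Fintype ι] [DecidableEq ι]
    (A : Finset ι) :
    ∫ s : Fin (A.card + 1) → G, hardCore E s univ ∂(Measure.pi fun _ => μ) =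
      ∑ B ∈ A.powerset, (∫ s : ι → G, hardCoreUrsell E s B ∂(Measure.pi fun _ => μ)) *
        ∫ s : Fin (A.card - B.card) → G, hardCore E s univ ∂(Measure.pi fun _ => μ) := by
  rw [← integral_rootedHardCore_eq hE A]
  simp only [fun s : ι → G => (sum_rootedUrsell_mul (rootedHardCore E s) _ (hardCore_empty E s) A).symm]
  rw [integral_finsetSum]
  · refine Finset.sum_congr rfl fun B hB => ?_
    rw [Finset.mem_powerset] at hB
    rw [← Finset.card_sdiff_of_subset hB, ← integral_hardCore_eq hE (A \ B)]
    refine integral_mul_eq_of_dependsOn μ (dependsOn_hardCoreUrsell E B) (fun s t h => ?_)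
    exact dependsOn_hardCore E (A \ B) fun i hi => h i (Finset.mem_sdiff.1 hi).2
  · intro B _
    exact ((memLp_hardCore hE (A \ B)).mul (p := ⊤) (q := ⊤) (r := ⊤)
      (memLp_hardCoreUrsell hE B)).integrable le_top

/-- The integral of the rooted Ursell function depends only on the number of points. -/
theorem integral_hardCoreUrsell_eq (hE : NullMeasurableSet E μ) {k : ℕ} (A : Finset (Fin k)) :
    ∫ s : Fin k → G, hardCoreUrsell E s A ∂(Measure.pi fun _ => μ) =
      ∫ s : Fin A.card → G, hardCoreUrsell E s univ ∂(Measure.pi fun _ => μ) := by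
  let c : ℕ → ℝ := fun n => ∫ s : Fin n → G, hardCore E s univ ∂(Measure.pi fun _ => μ)
  let w : ℕ → ℝ := fun n => ∫ s : Fin n → G, hardCoreUrsell E s univ ∂(Measure.pi fun _ => μ)
  obtain ⟨n, hn⟩ : ∃ n, A.card = n := ⟨_, rfl⟩
  induction n using Nat.strong_induction_on generalizing k with
  | _ n ih =>
    have hc : c 0 = 1 := by simp [c, hardCore_empty]
    -- The right side depends only on `n`. Since `c 0 = 1`, subtracting `w n` removes the summand `m
    -- = n`, so only smaller clusters enter.
    have key : ∀ {l : ℕ} (B : Finset (Fin l)), B.card = n →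
        ∫ s : Fin l → G, hardCoreUrsell E s B ∂(Measure.pi fun _ => μ) =
          c (n + 1) - (∑ m ∈ range (n + 1), n.choose m • (w m * c (n - m)) - w n) := by
      intro l B hB
      have h1 := integral_hardCore_succ_eq_sum hE B
      have h2 := sum_powerset_apply_card (fun m => w m * c (n - m)) (x := B)
      rw [sum_powerset_eq_add_sum_ssubsets] at h1 h2
      have h3 : ∑ C ∈ B.ssubsets, (∫ s, hardCoreUrsell E s C ∂(Measure.pi fun _ => μ)) *
          ∫ s : Fin (B.card - C.card) → G, hardCore E s univ ∂(Measure.pi fun _ => μ) =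
          ∑ C ∈ B.ssubsets, w C.card * c (n - C.card) := by
        refine Finset.sum_congr rfl fun C hC => ?_
        rw [ih C.card (hB ▸ card_lt_card (mem_ssubsets.1 hC)) C rfl, hB]
      rw [h3] at h1
      simp only [hB, Nat.sub_self, hc, mul_one] at h2
      have h4 : ∫ s : Fin (B.card - B.card) → G, hardCore E s univ ∂(Measure.pi fun _ => μ) = 1 := by
        rw [Nat.sub_self]; exact hc
      rw [h4, mul_one, hB] at h1
      change c (n + 1) = _ at h1
      rw [h1, ← h2]
      ring
    rw [key A hn, hn, key univ (card_fin n)]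

theorem integral_hardCore_succ (hE : NullMeasurableSet E μ) (k : ℕ) :
    ∫ s : Fin (k + 1) → G, hardCore E s univ ∂(Measure.pi fun _ => μ) =
      ∑ m ∈ range (k + 1), (k.choose m : ℝ) *
        (∫ s : Fin m → G, hardCoreUrsell E s univ ∂(Measure.pi fun _ => μ)) *
        ∫ s : Fin (k - m) → G, hardCore E s univ ∂(Measure.pi fun _ => μ) := by
  have h1 := integral_hardCore_succ_eq_sum hE (univ : Finset (Fin k))
  rw [Finset.sum_congr rfl fun B _ => by rw [integral_hardCoreUrsell_eq hE B]] at h1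
  rw [card_fin, sum_powerset_apply_card fun m =>
    (∫ s : Fin m → G, hardCoreUrsell E s univ ∂(Measure.pi fun _ => μ)) *
        ∫ s : Fin (k - m) → G, hardCore E s univ ∂(Measure.pi fun _ => μ), card_fin] at h1
  simpa only [nsmul_eq_mul, mul_assoc] using h1

end Gas

/-! ### Scaling of product measures -/

section PiSMul
open scoped NNReal

theorem MeasureTheory.Measure.pi_nnreal_smul {ι : Type*} [Fintype ι] {α : ι → Type*}
    [∀ i, MeasurableSpace (α i)] (μ : ∀ i, Measure (α i)) [∀ i, IsFiniteMeasure (μ i)] (c : ℝ≥0) :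
    Measure.pi (fun i => c • μ i) = c ^ Fintype.card ι • Measure.pi μ := by
  refine Measure.pi_eq fun s _ => ?_
  simp only [Measure.smul_apply, Measure.pi_pi, ENNReal.smul_def, smul_eq_mul,
    Finset.prod_mul_distrib, Finset.prod_const, Finset.card_univ, ENNReal.coe_pow]

end PiSMul

/-! ### The torus as a quotient of Euclidean space -/

section Torus
open Set

variable {d : ℕ} {L : ℝ}

/-- The quotient map from the product of `d` lines to the torus. -/
def torusMk (d : ℕ) (L : ℝ) (x : Fin d → ℝ) : Torus d L := fun i => (x i : AddCircle L)

@[simp]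
theorem torusMk_sub (x y : Fin d → ℝ) : torusMk d L (x - y) = torusMk d L x - torusMk d L y := rfl

@[simp]
theorem torusMk_neg (x : Fin d → ℝ) : torusMk d L (-x) = -torusMk d L x := rfl

theorem torusMk_eq_iff {x y : Fin d → ℝ} :
    torusMk d L x = torusMk d L y ↔ ∃ n : Fin d → ℤ, x = y + fun i => n i * L := by
  simp only [torusMk, funext_iff, Pi.add_apply]
  refine ⟨fun h => ?_, fun ⟨n, hn⟩ i => ?_⟩
  · have : ∀ i, ∃ n : ℤ, x i = y i + n * L := fun i => by
      have h' : ((x i - y i : ℝ) : AddCircle L) = 0 := by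
        rw [AddCircle.coe_sub, h i, sub_self]
      obtain ⟨n, hn⟩ := (AddCircle.coe_eq_zero_iff L).1 h'
      exact ⟨n, by rw [← zsmul_eq_mul, hn]; ring⟩
    exact Classical.skolem.1 this
  · rw [hn i, AddCircle.coe_add, ← zsmul_eq_mul, AddCircle.coe_zsmul, AddCircle.coe_period, smul_zero, add_zero]

theorem norm_torusMk_le (x : Fin d → ℝ) : ‖torusMk d L x‖ ≤ ‖x‖ :=
  (pi_norm_le_iff_of_nonneg (norm_nonneg x)).2 fun i =>
    (QuotientAddGroup.norm_mk_le_norm).trans (norm_le_pi_norm x i)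

theorem norm_torusMk_eq (hL : 0 < L) {x : Fin d → ℝ} (hx : ∀ i, |x i| ≤ L / 2) :
    ‖torusMk d L x‖ = ‖x‖ := by
  refine (norm_torusMk_le x).antisymm ((pi_norm_le_iff_of_nonneg (norm_nonneg _)).2 fun i => ?_)
  rw [Real.norm_eq_abs, ← (AddCircle.norm_coe_eq_abs_iff L hL.ne').2
    (by rw [abs_of_pos hL]; exact hx i)]
  exact norm_le_pi_norm (torusMk d L x) i

/-- On vectors that are short compared to `L`, the quotient map detects membership in a bounded
set. -/
theorem torusMk_mem_image_iff {D : Set (Fin d → ℝ)} {R : ℝ} (hD : ∀ x ∈ D, ‖x‖ ≤ R)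
    {x : Fin d → ℝ} (hx : ‖x‖ + R < L) : torusMk d L x ∈ torusMk d L '' D ↔ x ∈ D := by
  refine ⟨?_, mem_image_of_mem _⟩
  rintro ⟨z, hz, hzx⟩
  obtain ⟨n, hn⟩ := torusMk_eq_iff.1 hzx.symm
  have hL : 0 < L := by linarith [norm_nonneg x, norm_nonneg z, hD z hz]
  have : x = z := by
    rw [hn]
    ext i
    suffices n i = 0 by simp [this]
    have h1 : x i - z i = n i * L := by rw [hn]; simp
    have h2 : |x i - z i| < L := by
      have h3 := norm_le_pi_norm x i
      have h4 := norm_le_pi_norm z i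
      have h5 := abs_sub (x i) (z i)
      rw [Real.norm_eq_abs] at h3 h4
      linarith [hD z hz]
    rw [h1, abs_mul, abs_of_pos hL] at h2
    have h6 : |(n i : ℝ)| < 1 := by nlinarith
    rw [← Int.cast_abs, ← Int.cast_one, Int.cast_lt] at h6
    exact Int.abs_lt_one_iff.1 h6
  rwa [this]

variable [hL : Fact (0 < L)]

instance isAddHaarMeasure_uniformTorus : (uniformTorus d L).IsAddHaarMeasure := by
  unfold uniformTorus; infer_instance

/-- The fundamental domain is centred at `0` so that its points are shortest representatives, as
`norm_torusMk_eq` requires. -/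
theorem measurePreserving_torusMk :
    MeasurePreserving (torusMk d L)
      (volume.restrict (univ.pi fun _ => Ioc (-(L / 2)) (-(L / 2) + L)))
      (Measure.pi fun _ => volume) := by
  rw [volume_pi, Measure.restrict_pi_pi]
  exact measurePreserving_pi _ _ fun _ => AddCircle.measurePreserving_mk L _

theorem pi_volume_eq_smul_uniformTorus :
    (Measure.pi fun _ => volume : Measure (Torus d L)) = L.toNNReal ^ d • uniformTorus d L := by
  have h : (volume : Measure (AddCircle L)) = L.toNNReal • AddCircle.haarAddCircle := rfl
  rw [h, Measure.pi_nnreal_smul, Fintype.card_fin, uniformTorus]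

/-- The unrolling formula: integrals over a power of the torus are integrals over a box. -/
theorem integral_placementLaw {k : ℕ} {F : (Fin k → Torus d L) → ℝ}
    (hF : AEStronglyMeasurable F (placementLaw d L k)) :
    L ^ (d * k) * ∫ t, F t ∂(placementLaw d L k) =
      ∫ x in univ.pi fun _ : Fin k => univ.pi fun _ : Fin d => Ioc (-(L / 2)) (-(L / 2) + L),
        F fun i => torusMk d L (x i) := by
  have h1 : (Measure.pi fun _ => Measure.pi fun _ => volume : Measure (Fin k → Torus d L)) =
      L.toNNReal ^ (d * k) • placementLaw d L k := by
    rw [pi_volume_eq_smul_uniformTorus, Measure.pi_nnreal_smul, Fintype.card_fin, ← pow_mul,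
      placementLaw]
  have h2 : MeasurePreserving (fun (x : Fin k → Fin d → ℝ) i => torusMk d L (x i))
      (volume.restrict (univ.pi fun _ : Fin k => univ.pi fun _ : Fin d =>
        Ioc (-(L / 2)) (-(L / 2) + L)))
      (Measure.pi fun _ => Measure.pi fun _ => volume) := by
    rw [volume_pi, Measure.restrict_pi_pi]
    exact measurePreserving_pi _ _ fun _ => measurePreserving_torusMk
  have h3 : AEStronglyMeasurable F (Measure.pi fun _ => Measure.pi fun _ => volume) := by
    rw [h1]; exact hF.mono_ac Measure.smul_absolutelyContinuous
  rw [← integral_map h2.aemeasurable (by rwa [h2.map_eq]), h2.map_eq, h1,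
    integral_smul_nnreal_measure, NNReal.smul_def, smul_eq_mul, NNReal.coe_pow,
    Real.coe_toNNReal _ hL.out.le]

/-- The image of a null measurable set in the torus is null measurable. -/
theorem nullMeasurableSet_image_torusMk {D : Set (Fin d → ℝ)} (hD : NullMeasurableSet D) :
    NullMeasurableSet (torusMk d L '' D) (uniformTorus d L) := by
  -- The image is the preimage under this measure-preserving section of its saturation, a countable
  -- union of lattice translates of `D`.
  let σ : Torus d L → Fin d → ℝ := fun t i => (AddCircle.equivIoc L 0 (t i) : ℝ)
  have hσ : MeasurePreserving σ (Measure.pi fun _ => volume)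
      (Measure.pi fun _ => volume.restrict (Ioc 0 (0 + L))) :=
    measurePreserving_pi _ _ fun _ =>
      (measurePreserving_subtype_coe measurableSet_Ioc).comp (AddCircle.measurePreserving_equivIoc L)
  have hπσ : ∀ t, torusMk d L (σ t) = t := fun t => funext fun i => AddCircle.coe_equivIoc
  have hpre : torusMk d L ⁻¹' (torusMk d L '' D) =
      ⋃ n : Fin d → ℤ, (fun x : Fin d → ℝ => x + fun i => n i * L) ⁻¹' D := by
    ext x
    simp only [mem_preimage, mem_image, mem_iUnion, torusMk_eq_iff]
    constructor
    · rintro ⟨_, hy, n, rfl⟩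
      exact ⟨n, hy⟩
    · rintro ⟨n, hn⟩
      exact ⟨_, hn, n, rfl⟩
  have h1 : NullMeasurableSet (torusMk d L ⁻¹' (torusMk d L '' D)) := by
    rw [hpre]
    exact .iUnion fun n => hD.preimage (measurePreserving_add_right volume _).quasiMeasurePreserving
  have h2 : torusMk d L '' D = σ ⁻¹' (torusMk d L ⁻¹' (torusMk d L '' D)) := by
    ext t; rw [mem_preimage, mem_preimage, hπσ]
  rw [← Measure.restrict_pi_pi] at hσ
  rw [h2]
  have h3 := (h1.mono_ac Measure.restrict_le_self.absolutelyContinuous).preimage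
    hσ.quasiMeasurePreserving
  refine h3.mono_ac ?_
  rw [pi_volume_eq_smul_uniformTorus]
  refine Measure.absolutelyContinuous_smul (c := ((L.toNNReal ^ d : NNReal) : ENNReal)) ?_
  rw [ENNReal.coe_ne_zero]
  exact (pow_pos (Real.toNNReal_pos.2 hL.out) d).ne'

end Torus

/-! ### Independence of the torus size -/

section Limit
open Finset

theorem hardCoreUrsell_congr {ι G H : Type*} [DecidableEq ι] [AddGroup G] [AddGroup H]
    {E : Set G} {E' : Set H} {s : ι → G} {t : ι → H} (h₀ : ∀ i, s i ∈ E ↔ t i ∈ E')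
    (h₁ : ∀ i, -s i ∈ E ↔ -t i ∈ E') (h₂ : ∀ i j, s i - s j ∈ E ↔ t i - t j ∈ E')
    (A : Finset ι) : hardCoreUrsell E s A = hardCoreUrsell E' t A := by
  classical
  have h3 : hardCore E s = hardCore E' t := by
    ext A
    simp only [hardCore, Set.indicator_apply, hardCoreSet, Set.mem_ofPred_eq, h₂, Pi.one_apply]
  have h4 : rootedHardCore E s = rootedHardCore E' t := by
    ext A
    simp only [rootedHardCore, Set.indicator_apply, hardCoreSet, avoidSet, Set.mem_inter_iff,
      Set.mem_ofPred_eq, h₀, h₁, h₂, Pi.one_apply]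
  rw [hardCoreUrsell, hardCoreUrsell, h3, h4]

variable {d : ℕ} {L : ℝ} {D : Set (Fin d → ℝ)} {R : ℝ}

/-- If all points lie within `k * R` of the origin, the differences have norm at most `2 * k * R`,
and one further `R` rules out wrapping around. Otherwise both sides vanish by the support bound, the
torus norm being the true norm on the centred box. -/
theorem hardCoreUrsell_torusMk (hR : 0 ≤ R) (hD : ∀ x ∈ D, ‖x‖ ≤ R) {k : ℕ}
    (hL : (2 * k + 1) * R < L) {x : Fin k → Fin d → ℝ} (hx : ∀ i j, |x i j| ≤ L / 2) :
    hardCoreUrsell (torusMk d L '' D) (fun i => torusMk d L (x i)) univ =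
      hardCoreUrsell D x univ := by
  have hL0 : 0 < L := lt_of_le_of_lt (by positivity) hL
  by_cases h : ∀ i, ‖x i‖ ≤ k * R
  · have hkR : 0 ≤ k * R := by positivity
    refine hardCoreUrsell_congr (fun i => torusMk_mem_image_iff hD ?_) (fun i => ?_)
      (fun i j => ?_) univ
    · linarith [h i]
    · rw [← torusMk_neg]
      refine torusMk_mem_image_iff hD ?_
      rw [norm_neg]
      linarith [h i]
    · rw [← torusMk_sub]
      refine torusMk_mem_image_iff hD ?_
      linarith [h i, h j, norm_sub_le (x i) (x j)]
  · push Not at h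
    obtain ⟨i, hi⟩ := h
    trans 0
    · by_contra hne
      have h1 := norm_le_of_hardCoreUrsell_ne_zero hR (fun y hy => ?_) hne (mem_univ i)
      · rw [card_fin, norm_torusMk_eq hL0 (hx i)] at h1
        exact h1.not_gt hi
      · obtain ⟨z, hz, rfl⟩ := hy
        exact (norm_torusMk_le z).trans (hD z hz)
    · by_contra! hne
      have h1 := norm_le_of_hardCoreUrsell_ne_zero hR hD hne.symm (mem_univ i)
      rw [card_fin] at h1
      exact h1.not_gt hi

/-- On large tori the integral of the rooted Ursell function does not depend on the torus. -/
theorem integral_hardCoreUrsell_torus [Fact (0 < L)] (hR : 0 ≤ R) (hD : ∀ x ∈ D, ‖x‖ ≤ R)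
    (hDm : NullMeasurableSet D) {k : ℕ} (hL : (2 * k + 1) * R < L) :
    L ^ (d * k) * ∫ t, hardCoreUrsell (torusMk d L '' D) t univ ∂(placementLaw d L k) =
      ∫ x : Fin k → Fin d → ℝ, hardCoreUrsell D x univ := by
  have hmeas : AEStronglyMeasurable
      (fun t => hardCoreUrsell (torusMk d L '' D) t univ) (placementLaw d L k) :=
    (memLp_hardCoreUrsell (nullMeasurableSet_image_torusMk hDm) univ).1
  have hbox : MeasurableSet (Set.univ.pi fun _ : Fin k => Set.univ.pi fun _ : Fin d =>
      Set.Ioc (-(L / 2)) (-(L / 2) + L)) :=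
    .univ_pi fun _ => .univ_pi fun _ => measurableSet_Ioc
  rw [integral_placementLaw hmeas, setIntegral_congr_fun hbox fun x hx => ?_]
  · refine setIntegral_eq_integral_of_forall_compl_eq_zero fun x hx => ?_
    by_contra hne
    refine hx fun i _ j _ => ?_
    have h1 := norm_le_of_hardCoreUrsell_ne_zero hR hD hne (mem_univ i)
    rw [card_fin] at h1
    have h2 := abs_le.1 ((norm_le_pi_norm (x i) j).trans h1)
    constructor <;> linarith [h2.1, h2.2]
  · refine hardCoreUrsell_torusMk hR hD hL fun i j => abs_le.2 ?_
    have := hx i trivial j trivial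
    constructor <;> linarith [this.1, this.2]

end Limit

/-! ### Binomial convolution and sequences of binomial type -/

section Binomial
open Finset

/-- The polynomial sequence with `P 0 = 1` and `P (k + 1) = X * ∑ m, k.choose m * a m * P (k - m)`. -/
noncomputable def clusterPoly (a : ℕ → ℝ) : ℕ → ℝ[X]
  | 0 => 1
  | k + 1 => X * ∑ m ∈ (range (k + 1)).attach,
      C ((k.choose m.1 : ℝ) * a m.1) * clusterPoly a (k - m.1)
termination_by k => k
decreasing_by omega

theorem clusterPoly_zero (a : ℕ → ℝ) : clusterPoly a 0 = 1 := by
  rw [clusterPoly]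

theorem eval_clusterPoly_succ (a : ℕ → ℝ) (k : ℕ) (x : ℝ) : (clusterPoly a (k + 1)).eval x =
    x * ∑ m ∈ range (k + 1), (k.choose m : ℝ) * a m * (clusterPoly a (k - m)).eval x := by
  rw [clusterPoly, sum_attach (range (k + 1)) fun m =>
    C ((k.choose m : ℝ) * a m) * clusterPoly a (k - m)]
  simp [eval_finsetSum]

/-- Associativity of binomial convolution. -/
theorem sum_choose_mul_sum_choose {R : Type*} [CommSemiring R] (a b c : ℕ → R) (k : ℕ) :
    ∑ i ∈ range (k + 1), (k.choose i : R) *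
        (∑ m ∈ range (i + 1), (i.choose m : R) * a m * b (i - m)) * c (k - i) =
      ∑ m ∈ range (k + 1), (k.choose m : R) * a m *
        ∑ j ∈ range (k - m + 1), ((k - m).choose j : R) * b j * c (k - m - j) := by
  simp only [mul_sum, sum_mul]
  rw [sum_sigma', sum_sigma']
  refine sum_bij' (fun p _ => ⟨p.2, p.1 - p.2⟩) (fun p _ => ⟨p.1 + p.2, p.1⟩) ?_ ?_ ?_ ?_ ?_
  · rintro ⟨i, m⟩ h; simp only [mem_sigma, mem_range] at h ⊢; omega
  · rintro ⟨i, m⟩ h; simp only [mem_sigma, mem_range] at h ⊢; omega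
  · rintro ⟨i, m⟩ h
    simp only [mem_sigma, mem_range] at h
    simp only [Sigma.mk.injEq, heq_eq_eq, and_true]; omega
  · rintro ⟨i, m⟩ h
    simp
  · rintro ⟨i, m⟩ h
    simp only [mem_sigma, mem_range] at h
    have h1 : k.choose i * i.choose m = k.choose m * (k - m).choose (i - m) :=
      Nat.choose_mul (by omega)
    have h2 : k - m - (i - m) = k - i := by omega
    have h3 : (k.choose i : R) * i.choose m = k.choose m * (k - m).choose (i - m) := by
      exact_mod_cast congrArg (Nat.cast : ℕ → R) h1
    rw [h2]
    calc _ = ((k.choose i : R) * i.choose m) * (a m * b (i - m) * c (k - i)) := by ring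
      _ = _ := by rw [h3]; ring

theorem sum_choose_reflect {R : Type*} [CommSemiring R] (b c : ℕ → R) (k : ℕ) :
    ∑ i ∈ range (k + 1), (k.choose i : R) * b i * c (k - i) =
      ∑ i ∈ range (k + 1), (k.choose i : R) * c i * b (k - i) := by
  rw [← sum_range_reflect]
  refine sum_congr rfl fun i hi => ?_
  have hi' : i ≤ k := by rw [mem_range] at hi; omega
  rw [show k + 1 - 1 - i = k - i by omega, Nat.choose_symm hi', Nat.sub_sub_self hi']
  ring

/-- This is the product rule for exponential generating functions. -/
theorem sum_choose_succ {R : Type*} [CommSemiring R] (b c : ℕ → R) (k : ℕ) :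
    ∑ i ∈ range (k + 2), ((k + 1).choose i : R) * b i * c (k + 1 - i) =
      ∑ i ∈ range (k + 1), (k.choose i : R) * b (i + 1) * c (k - i) +
        ∑ i ∈ range (k + 1), (k.choose i : R) * b i * c (k - i + 1) := by
  have h := sum_choose_succ_mul (fun i j => b i * c j) k
  simp only [← mul_assoc] at h
  rw [h, add_comm]
  congr 1
  refine sum_congr rfl fun i hi => ?_
  rw [mem_range] at hi
  rw [show k + 1 - i = k - i + 1 by omega]

/-- In generating functions, `F_x' = x A F_x` gives `(F_x F_y)' = (x + y) A F_x F_y`, the equation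
satisfied by `F_{x+y}`. The induction on `k` is uniqueness of its solution, coefficient by
coefficient. -/
theorem isBinomialType_clusterPoly (a : ℕ → ℝ) : IsBinomialType (clusterPoly a) where
  zero_eq_one := clusterPoly_zero a
  eval_zero k hk := by
    obtain ⟨k, rfl⟩ := Nat.exists_eq_succ_of_ne_zero hk.ne'
    rw [eval_clusterPoly_succ, zero_mul]
  eval_add k x y := by
    induction k using Nat.strong_induction_on with
    | _ k ih =>
      cases k with
      | zero => simp [clusterPoly_zero]
      | succ k =>
        have h : ∀ z w : ℝ, ∑ i ∈ range (k + 1), (k.choose i : ℝ) *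
            (clusterPoly a (i + 1)).eval z * (clusterPoly a (k - i)).eval w =
            z * ∑ m ∈ range (k + 1), (k.choose m : ℝ) * a m * ∑ j ∈ range (k - m + 1),
              ((k - m).choose j : ℝ) * (clusterPoly a j).eval z *
                (clusterPoly a (k - m - j)).eval w := fun z w => by
          rw [← sum_choose_mul_sum_choose a (fun i => (clusterPoly a i).eval z)
            fun i => (clusterPoly a i).eval w, mul_sum]
          refine sum_congr rfl fun i _ => ?_
          rw [eval_clusterPoly_succ]
          ring
        have hxy := h x y
        have hyx := h y x
        rw [eval_clusterPoly_succ, sum_choose_succ (fun i => (clusterPoly a i).eval x)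
          fun i => (clusterPoly a i).eval y, hxy,
          sum_choose_reflect (fun i => (clusterPoly a i).eval x)
            fun i => (clusterPoly a (i + 1)).eval y, hyx, add_mul]
        congr 2 <;> refine sum_congr rfl fun m hm => ?_
        · rw [ih (k - m) (by omega)]
        · rw [ih (k - m) (by omega), sum_choose_reflect (fun i => (clusterPoly a i).eval x)
            fun i => (clusterPoly a i).eval y]

end Binomial

/-! ### Assembly of the theorem -/

section Main
open Finset

/-- A common point `t + x = u + y` amounts to `t - u = y - x` in the torus. -/
theorem disjoint_copyAt_iff {d : ℕ} {L : ℝ} {S : Set (EuclideanSpace ℝ (Fin d))}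
    {t u : Torus d L} : Disjoint (copyAt L S t) (copyAt L S u) ↔
      t - u ∉ torusMk d L '' (WithLp.ofLp '' (S - S)) := by
  rw [← not_iff_not, not_not, Set.not_disjoint_iff]
  have key : ∀ x y : EuclideanSpace ℝ (Fin d),
      u + toTorus d L y = t + toTorus d L x ↔ torusMk d L (y - x).ofLp = t - u := fun x y => by
    have h : torusMk d L (y - x).ofLp = toTorus d L y - toTorus d L x := rfl
    rw [h, sub_eq_sub_iff_add_eq_add, add_comm u]
  constructor
  · rintro ⟨_, ⟨x, hx, rfl⟩, y, hy, hxy⟩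
    exact ⟨_, ⟨_, Set.sub_mem_sub hy hx, rfl⟩, (key x y).1 hxy⟩
  · rintro ⟨_, ⟨_, ⟨y, hy, x, hx, rfl⟩, rfl⟩, h⟩
    exact ⟨_, ⟨x, hx, rfl⟩, y, hy, (key x y).2 h⟩

theorem noOverlap_eq_hardCoreSet {d : ℕ} (L : ℝ) (S : Set (EuclideanSpace ℝ (Fin d))) (k : ℕ) :
    noOverlap L S k = hardCoreSet (torusMk d L '' (WithLp.ofLp '' (S - S))) univ := by
  ext t
  simp [noOverlap, hardCoreSet, disjoint_copyAt_iff]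

/-- For Borel `S`, the set `S - S` is a continuous image of `S ×ˢ S`, hence analytic, though it need
not be Borel. -/
theorem nullMeasurableSet_sub_self {d : ℕ} {S : Set (EuclideanSpace ℝ (Fin d))}
    (hmeas : MeasurableSet S ∨ (NullMeasurableSet S volume ∧ NullMeasurableSet (S - S) volume)) :
    NullMeasurableSet (S - S) volume := by
  rcases hmeas with h | h
  · rw [← Set.sub_image_prod]
    exact ((h.prod h).analyticSet.image_of_continuous continuous_sub).nullMeasurableSet
  · exact h.2

theorem mainTheorem9 (d : ℕ) (S : Set (EuclideanSpace ℝ (Fin d)))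
    (hbdd : Bornology.IsBounded S)
    (hmeas : MeasurableSet S ∨
      (NullMeasurableSet S volume ∧ NullMeasurableSet (S - S) volume)) :
    (∀ (L : ℝ) [Fact (0 < L)] (k : ℕ),
      NullMeasurableSet (noOverlap L S k) (placementLaw d L k)) ∧
    ∃ P : ℕ → ℝ[X],
      (∀ k : ℕ, ∃ L₀ : ℝ, ∀ (L : ℝ) [Fact (0 < L)], L₀ ≤ L →
        L ^ (d * k) * noOverlapProb L S k = (P k).eval (L ^ d)) ∧
      IsBinomialType P := by
  have hDm : NullMeasurableSet (WithLp.ofLp '' (S - S) : Set (Fin d → ℝ)) volume := by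
    have h := (nullMeasurableSet_sub_self hmeas).preimage
      (PiLp.volume_preserving_toLp (Fin d)).quasiMeasurePreserving
    have heq : (WithLp.ofLp '' (S - S) : Set (Fin d → ℝ)) = WithLp.toLp 2 ⁻¹' (S - S) :=
      Set.ext fun x => ⟨by rintro ⟨y, hy, rfl⟩; exact hy, fun hx => ⟨_, hx, rfl⟩⟩
    rwa [heq]
  obtain ⟨R, hR, hD⟩ : ∃ R : ℝ, 0 ≤ R ∧
      ∀ x ∈ (WithLp.ofLp '' (S - S) : Set (Fin d → ℝ)), ‖x‖ ≤ R := by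
    obtain ⟨R, hR, h⟩ := (hbdd.sub hbdd).exists_pos_norm_le
    refine ⟨R, hR.le, ?_⟩
    rintro _ ⟨y, hy, rfl⟩
    exact ((pi_norm_le_iff_of_nonneg (norm_nonneg y)).2 fun i => PiLp.norm_apply_le y i).trans
      (h y hy)
  set D : Set (Fin d → ℝ) := WithLp.ofLp '' (S - S)
  have hE : ∀ (L : ℝ) [Fact (0 < L)], NullMeasurableSet (torusMk d L '' D) (uniformTorus d L) :=
    fun L _ => nullMeasurableSet_image_torusMk hDm
  have hnull : ∀ (L : ℝ) [Fact (0 < L)] (k : ℕ),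
      NullMeasurableSet (noOverlap L S k) (placementLaw d L k) := fun L _ k => by
    rw [noOverlap_eq_hardCoreSet]
    exact nullMeasurableSet_hardCoreSet (hE L) univ
  have hprob : ∀ (L : ℝ) [Fact (0 < L)] (k : ℕ), noOverlapProb L S k =
      ∫ t, hardCore (torusMk d L '' D) t univ ∂(placementLaw d L k) := fun L _ k => by
    have h := hnull L k
    rw [noOverlapProb]
    rw [noOverlap_eq_hardCoreSet] at h ⊢
    simp only [hardCore]
    rw [integral_indicator₀ h]
    simp
  let a : ℕ → ℝ := fun m => ∫ x : Fin m → Fin d → ℝ, hardCoreUrsell D x univ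
  -- The summand `1` makes the bound on `L` strict. The threshold increases with `k`, so it also
  -- serves every smaller cluster and the induction hypotheses.
  refine ⟨hnull, clusterPoly a, fun k => ⟨(2 * k + 1) * R + 1, fun L _ hL => ?_⟩,
    isBinomialType_clusterPoly a⟩
  induction k using Nat.strong_induction_on with
  | _ k ih =>
    cases k with
    | zero => simp [hprob, hardCore_empty, clusterPoly_zero, placementLaw]
    | succ k =>
      have hrec : noOverlapProb L S (k + 1) = _ :=
        (hprob L (k + 1)).trans (integral_hardCore_succ (hE L) k)
      rw [hrec, eval_clusterPoly_succ, mul_sum, mul_sum]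
      refine sum_congr rfl fun m hm => ?_
      have hmk : m ≤ k := by rw [mem_range] at hm; omega
      have hLm : ∀ j ≤ k + 1, (2 * (j : ℝ) + 1) * R + 1 ≤ L := fun j hj => by
        have : (j : ℝ) ≤ (k + 1 : ℕ) := by exact_mod_cast hj
        refine le_trans ?_ hL
        gcongr
      have h1 := integral_hardCoreUrsell_torus (L := L) (k := m) hR hD hDm
        (by linarith [hLm m (by omega)])
      have h2 := ih (k - m) (by omega) (hLm _ (by omega))
      rw [hprob] at h2
      change _ = L ^ d * ((k.choose m : ℝ) * (∫ x : Fin m → Fin d → ℝ, _) * _)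
      -- The powers of `L` split among the root (`d`), its cluster (`d * m`) and the remaining
      -- points (`d * (k - m)`).
      rw [← h1, ← h2, show d * (k + 1) = d + d * m + d * (k - m) by
        conv_lhs => rw [← Nat.add_sub_of_le hmk]
        ring, pow_add, pow_add]
      simp only [placementLaw]
      ring

end Main
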